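/- Let $N$ be a nonnegative integer and let $\hat A\in\mathbb R^{N\times N}$ be a matrix with zero row sums and nonnegative off-diagonal entries. Let $\{A(t)\}_{t\ge 0}$ be the time-invariant chain $A(t)=\hat A$ for all $t\ge 0$. For a chain $\{A(t)\}_{t\ge 0}$ let $\Phi(t,\tau)$, $t\ge\tau\ge 0$, be the state transition matrix of $\dot x(t)=A(t)x(t)$, given by the Peano–Baker series $$\Phi(t,\tau)=I+\int_\tau^t A(\sigma_1)\,d\sigma_1+\int_\tau^t A(\sigma_1)\int_\tau^{\sigma_1}A(\sigma_2)\,d\sigma_2\,d\sigma_1+\cdots.$$ Let $\mathbf{Null}_\tau(A)=\{v\in\mathbb R^N : \lim_{t\to\infty}\Phi(t,\tau)v=0\}$. Let $\mathbf{Nullity}(A)=\dim\mathbf{Null}_0(A)$, and let $\mathbf{Rank}(A)=N-\mathbf{Nullity}(A)$. The unbounded interactions graph of the chain is the directed graph on $\{1,\dots,N\}$ with a link from $i$ to $j$, $i\ne j$, if and only if $\int_0^\infty a_{ji}(t)\,dt=\infty$. An s-root of a directed graph is a set $S$ of nodes such that every node is in $S$ or is reachable along a directed path from some node of $S$. Then,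 for the time-invariant chain $A(t)=\hat A$: $\dim\mathbf{Null}_\tau(A)=\mathbf{Nullity}(A)$ for every $\tau\ge 0$; $\mathbf{Rank}(A)=\mathrm{nullity}(\hat A)$, the dimension of the kernel of $\hat A$; and $\mathbf{Rank}(A)$ equals the size of the smallest s-root of the unbounded interactions graph of $\{A(t)\}$. -/

import Mathlib

open MeasureTheory Filter Topology

noncomputable section

/-- The terms of the Peano-Baker series of the chain `A` with initial time `τ`: the `0`-th term is
the identity matrix, and the next term at time `t` is the (entrywise) integral over `[τ, t]` of
`A σ` times the previous term at time `σ`. -/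
def peanoBakerTerm {N : ℕ} (A : ℝ → Matrix (Fin N) (Fin N) ℝ) (τ : ℝ) :
    ℕ → ℝ → Matrix (Fin N) (Fin N) ℝ
  | 0, _ => 1
  | k + 1, t => Matrix.of fun i j => ∫ σ in τ..t, (A σ * peanoBakerTerm A τ k σ) i j

/-- The state transition matrix `Φ(t, τ)` of the chain `A`, as the sum of its Peano-Baker series.
For `t ≥ τ ≥ 0` it depends only on the values of `A` at nonnegative times. -/
def stateTransition {N : ℕ} (A : ℝ → Matrix (Fin N) (Fin N) ℝ) (t τ : ℝ) :
    Matrix (Fin N) (Fin N) ℝ :=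
  Matrix.of fun i j => ∑' k : ℕ, peanoBakerTerm A τ k t i j

/-- The null space of the chain `A` at time `τ`: all vectors `v` with `Φ(t, τ) v → 0` as
`t → ∞`. -/
def chainNull {N : ℕ} (A : ℝ → Matrix (Fin N) (Fin N) ℝ) (τ : ℝ) :
    Submodule ℝ (Fin N → ℝ) where
  carrier := {v | Tendsto (fun t : ℝ => (stateTransition A t τ).mulVec v) atTop (𝓝 0)}
  add_mem' := by
    intro a b ha hb
    simp only [Set.mem_ofPred_eq, Matrix.mulVec_add] at ha hb ⊢
    simpa using ha.add hb
  zero_mem' := by simp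
  smul_mem' := by
    intro c v hv
    simp only [Set.mem_ofPred_eq, Matrix.mulVec_smul] at hv ⊢
    simpa using hv.const_smul c

/-- The nullity of the chain `A`: the dimension of its null space, taken at time `0` (the dimension
at any other time `τ ≥ 0` is the same). -/
def chainNullity {N : ℕ} (A : ℝ → Matrix (Fin N) (Fin N) ℝ) : ℕ :=
  Module.finrank ℝ (chainNull A 0)

/-- The rank of the chain `A`. The nullity is at most `N`, so the subtraction does not truncate. -/
def chainRank {N : ℕ} (A : ℝ → Matrix (Fin N) (Fin N) ℝ) : ℕ :=
  N - chainNullity A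

/-- The unbounded interactions graph of the chain `A`: for distinct `i`, `j` there is a link from
`i` to `j` if and only if the integral of `a_{ji}` over `[0, ∞)` is infinite. (Off-diagonal entries
of a chain are nonnegative, so the integral is the Lebesgue integral with values in `[0, ∞]`.) -/
def unboundedInteractionsGraph {N : ℕ} (A : ℝ → Matrix (Fin N) (Fin N) ℝ) : Digraph (Fin N) where
  Adj i j := i ≠ j ∧ ∫⁻ t in Set.Ici (0 : ℝ), ENNReal.ofReal (A t j i) = ⊤

/-- `S` is an s-root of the directed graph `G`: every node belongs to `S` or is reachable along a
directed path from some node of `S`. -/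
def IsSRoot {V : Type*} (G : Digraph V) (S : Finset V) : Prop :=
  ∀ i : V, i ∈ S ∨ ∃ j ∈ S, Relation.TransGen G.Adj j i

end

/-!
The unbounded interactions graph is the graph of positive off-diagonal entries of `B := Ahat`, and
`Φ(t, τ) = exp ((t - τ) B)`.

*Rank.* The matrices `exp (s B)` fix `ker B` pointwise. Writing `B = c (P - 1)` with `P` stochastic
(uniformization), `exp (s (P - 1)) (P - 1)` is the mean of `(K / s - 1) Pᴷ` for a Poisson variable
`K` of mean and variance `s`, so its norm is at most `E|K / s - 1| ≤ 1 / √s`, and `exp (s B)` tends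
to zero on `range B`. By a dimension count the null space of the chain is exactly `range B`, whose
codimension is the dimension of `ker B`.

*S-roots.* Let `S` be an s-root and `v` a vector with `(B v) i = 0` off `S`. By the maximum
principle, `v i` lies between the extreme values of `v` at those elements of `S` from which `i` is
reachable. So `v` is determined by its values on `S`, these values can be prescribed, and
restriction to `S` embeds `ker B` into `ℝ^S`. If moreover `S` is a minimal s-root, none of its
elements is reachable from another, so `v` takes the value `v i` at all predecessors of a node
`i ∈ S`; then `v ∈ ker B`, and the embedding is onto.
-/

open Matrix Relation

lemma eq_range_of_range_le_of_disjoint_ker {K E : Type*} [DivisionRing K] [AddCommGroup E]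
    [Module K E] [FiniteDimensional K E] {f : E →ₗ[K] E} {p : Submodule K E}
    (hrange : LinearMap.range f ≤ p) (hker : Disjoint p (LinearMap.ker f)) :
    p = LinearMap.range f := by
  have hdim := Submodule.finrank_add_finrank_le_of_disjoint hker
  have hrn := f.finrank_range_add_finrank_ker
  exact (Submodule.eq_of_le_of_finrank_le hrange (by lia)).symm

section SRoot

variable {V : Type*} {G : Digraph V} {S : Finset V}

lemma isSRoot_iff_reflTransGen :
    IsSRoot G S ↔ ∀ i, ∃ s ∈ S, ReflTransGen G.Adj s i := by
  refine forall_congr' fun i => ⟨?_, ?_⟩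
  · rintro (hi | ⟨s, hs, hsi⟩)
    · exact ⟨i, hi, .refl⟩
    · exact ⟨s, hs, hsi.to_reflTransGen⟩
  · rintro ⟨s, hs, hsi⟩
    rcases reflTransGen_iff_eq_or_transGen.1 hsi with rfl | hsi
    · exact .inl hs
    · exact .inr ⟨s, hs, hsi⟩

lemma isAntichain_of_minimal_isSRoot (hS : Minimal (IsSRoot G) S) :
    IsAntichain (ReflTransGen G.Adj) (S : Set V) := by
  classical
  intro r hr s hs hne hrs
  have hroot : IsSRoot G (S.erase s) := by
    rw [isSRoot_iff_reflTransGen]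
    intro i
    obtain ⟨t, ht, hti⟩ := isSRoot_iff_reflTransGen.1 hS.prop i
    rcases eq_or_ne t s with rfl | hts
    · exact ⟨r, Finset.mem_erase.2 ⟨hne, hr⟩, hrs.trans hti⟩
    · exact ⟨t, Finset.mem_erase.2 ⟨hts, ht⟩, hti⟩
  exact Finset.notMem_erase s S (hS.le_of_le hroot (Finset.erase_subset s S) hs)

lemma exists_isSRoot_isAntichain [Finite V] (G : Digraph V) :
    ∃ S : Finset V, IsSRoot G S ∧ IsAntichain (ReflTransGen G.Adj) (S : Set V) := by
  cases nonempty_fintype V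
  obtain ⟨S, hS⟩ := exists_minimal_of_wellFoundedLT (IsSRoot G)
    ⟨Finset.univ, fun i => .inl (Finset.mem_univ i)⟩
  exact ⟨S, hS.prop, isAntichain_of_minimal_isSRoot hS⟩

end SRoot

section Dirichlet

variable {V R : Type*} [CommRing R] [Fintype V]

/-- The operator of the discrete Dirichlet problem for `B` with boundary `S`: it sends `v` to its
boundary values on `S` and to `B v` elsewhere. -/
def dirichletMap [DecidableEq V] (B : Matrix V V R) (S : Finset V) : (V → R) →ₗ[R] (V → R) :=
  LinearMap.pi fun i => if i ∈ S then LinearMap.proj i else LinearMap.proj i ∘ₗ B.mulVecLin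

lemma dirichletMap_apply [DecidableEq V] (B : Matrix V V R) (S : Finset V) (v : V → R) (i : V) :
    dirichletMap B S v i = if i ∈ S then v i else (B *ᵥ v) i := by
  unfold dirichletMap
  split_ifs with hi <;> simp [hi]

/-- Restriction of the vectors in the kernel of `B` to the nodes in `S`, used to compare the
dimension of the kernel with the size of an s-root. -/
def kerRestrict (B : Matrix V V R) (S : Finset V) : LinearMap.ker B.mulVecLin →ₗ[R] (S → R) :=
  LinearMap.funLeft R R Subtype.val ∘ₗ (LinearMap.ker B.mulVecLin).subtype

end Dirichlet

section MaximumPrinciple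

variable {V R : Type*} [CommRing R] [LinearOrder R]

/-- A rate matrix, that is, the generator of a continuous-time Markov chain: its rows sum to zero
and its off-diagonal entries are nonnegative. The values `A t` of the chains under study
are of this kind. -/
structure IsRateMatrix [Fintype V] (B : Matrix V V R) : Prop where
  sum_row : ∀ i, ∑ j, B i j = 0
  offDiag_nonneg : ∀ i j, i ≠ j → 0 ≤ B i j

/-- The graph of positive off-diagonal entries of a matrix. As in `unboundedInteractionsGraph`, a
link from `i` to `j` stands for the entry `B j i`, the influence of node `i` on node `j`. -/
def influenceGraph (B : Matrix V V R) : Digraph V where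
  Adj i j := i ≠ j ∧ 0 < B j i

variable [Fintype V] {B : Matrix V V R} {S : Finset V} {v : V → R}

namespace IsRateMatrix

lemma mulVec_apply (hB : IsRateMatrix B) (v : V → R) (i : V) :
    (B *ᵥ v) i = ∑ j, B i j * (v j - v i) := by
  simp only [mulVec, dotProduct, mul_sub, Finset.sum_sub_distrib, ← Finset.sum_mul, hB.sum_row,
    zero_mul, sub_zero]

lemma mul_sub_eq_zero_of_not_adj (hB : IsRateMatrix B) {i j : V}
    (h : ¬(influenceGraph B).Adj j i) : B i j * (v j - v i) = 0 := by
  rcases eq_or_ne j i with rfl | hji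
  · rw [sub_self, mul_zero]
  · have hij : B i j = 0 :=
      le_antisymm (not_lt.1 fun hpos => h ⟨hji, hpos⟩) (hB.offDiag_nonneg i j hji.symm)
    rw [hij, zero_mul]

lemma mulVec_apply_eq_zero_of_forall_adj (hB : IsRateMatrix B) {i : V}
    (h : ∀ j, (influenceGraph B).Adj j i → v j = v i) : (B *ᵥ v) i = 0 := by
  rw [hB.mulVec_apply]
  refine Finset.sum_eq_zero fun j _ => ?_
  by_cases hj : (influenceGraph B).Adj j i
  · rw [h j hj, sub_self, mul_zero]
  · exact hB.mul_sub_eq_zero_of_not_adj hj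

variable [IsStrictOrderedRing R]

lemma eq_of_adj_of_forall_adj_le (hB : IsRateMatrix B) {i j : V} (hv : 0 ≤ (B *ᵥ v) i)
    (hmax : ∀ k, (influenceGraph B).Adj k i → v k ≤ v i) (hj : (influenceGraph B).Adj j i) :
    v j = v i := by
  have hterm : ∀ k ∈ Finset.univ, B i k * (v k - v i) ≤ 0 := fun k _ => by
    by_cases hk : (influenceGraph B).Adj k i
    · exact mul_nonpos_of_nonneg_of_nonpos hk.2.le (sub_nonpos.2 (hmax k hk))
    · exact (hB.mul_sub_eq_zero_of_not_adj hk).le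
  rw [hB.mulVec_apply] at hv
  have hsum := hv.antisymm' (Finset.sum_nonpos hterm)
  have hzero := (Finset.sum_eq_zero_iff_of_nonpos hterm).1 hsum j (Finset.mem_univ j)
  exact sub_eq_zero.1 ((mul_eq_zero.1 hzero).resolve_left hj.2.ne')

lemma exists_mem_eq_of_forall_reflTransGen_le (hB : IsRateMatrix B)
    (hv : ∀ i ∉ S, 0 ≤ (B *ᵥ v) i) {s i : V} (hs : s ∈ S)
    (hsi : ReflTransGen (influenceGraph B).Adj s i)
    (hmax : ∀ k, ReflTransGen (influenceGraph B).Adj k i → v k ≤ v i) :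
    ∃ r ∈ S, ReflTransGen (influenceGraph B).Adj r i ∧ v r = v i := by
  induction hsi with
  | refl => exact ⟨s, hs, .refl, rfl⟩
  | @tail j i _ hji ih =>
    by_cases hi : i ∈ S
    · exact ⟨i, hi, .refl, rfl⟩
    · have hj : v j = v i :=
        hB.eq_of_adj_of_forall_adj_le (hv i hi) (fun k hk => hmax k (.single hk)) hji
      obtain ⟨r, hr, hrj, hrv⟩ := ih fun k hk => hj ▸ hmax k (hk.tail hji)
      exact ⟨r, hr, hrj.tail hji, hrv.trans hj⟩

lemma le_of_forall_root_le (hB : IsRateMatrix B) (hS : IsSRoot (influenceGraph B) S)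
    (hv : ∀ i ∉ S, 0 ≤ (B *ᵥ v) i) {i : V} {c : R}
    (hc : ∀ s ∈ S, ReflTransGen (influenceGraph B).Adj s i → v s ≤ c) : v i ≤ c := by
  obtain ⟨m, hmi, hmax⟩ := Set.exists_max_image
    {k | ReflTransGen (influenceGraph B).Adj k i} v (Set.toFinite _) ⟨i, .refl⟩
  obtain ⟨s, hs, hsm⟩ := isSRoot_iff_reflTransGen.1 hS m
  obtain ⟨r, hr, hrm, hrv⟩ := hB.exists_mem_eq_of_forall_reflTransGen_le hv hs hsm
    fun k hk => hmax k (hk.trans hmi)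
  calc v i ≤ v m := hmax i .refl
    _ = v r := hrv.symm
    _ ≤ c := hc r hr (hrm.trans hmi)

lemma eq_of_forall_root_eq (hB : IsRateMatrix B) (hS : IsSRoot (influenceGraph B) S)
    (hv : ∀ i ∉ S, (B *ᵥ v) i = 0) {i : V} {c : R}
    (hc : ∀ s ∈ S, ReflTransGen (influenceGraph B).Adj s i → v s = c) : v i = c := by
  refine le_antisymm
    (hB.le_of_forall_root_le hS (fun j hj => (hv j hj).ge) fun s hs h => (hc s hs h).le) ?_
  have hneg : (-v) i ≤ -c :=
    hB.le_of_forall_root_le hS (fun j hj => by simp [mulVec_neg, hv j hj])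
      fun s hs h => by simp [hc s hs h]
  exact neg_le_neg_iff.1 hneg

end IsRateMatrix

end MaximumPrinciple

section Kernel

variable {V K : Type*} [Field K] [LinearOrder K] [IsStrictOrderedRing K] [Fintype V]
  {B : Matrix V V K} {S : Finset V} {v : V → K}

namespace IsRateMatrix

lemma dirichletMap_injective [DecidableEq V] (hB : IsRateMatrix B)
    (hS : IsSRoot (influenceGraph B) S) : Function.Injective (dirichletMap B S) := by
  rw [injective_iff_map_eq_zero]
  intro v hv
  have hv' (i : V) : (if i ∈ S then v i else (B *ᵥ v) i) = 0 := by
    rw [← dirichletMap_apply, hv, Pi.zero_apply]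
  refine funext fun i => hB.eq_of_forall_root_eq (c := 0) hS (fun j hj => ?_) fun s hs _ => ?_
  · simpa only [if_neg hj] using hv' j
  · simpa only [if_pos hs] using hv' s

lemma exists_harmonic_extension (hB : IsRateMatrix B) (hS : IsSRoot (influenceGraph B) S)
    (u : V → K) : ∃ v : V → K, (∀ s ∈ S, v s = u s) ∧ ∀ i ∉ S, (B *ᵥ v) i = 0 := by
  classical
  obtain ⟨v, hv⟩ := LinearMap.injective_iff_surjective.1 (hB.dirichletMap_injective hS)
    fun i => if i ∈ S then u i else 0
  have hv' (i : V) := (dirichletMap_apply B S v i).symm.trans (congrFun hv i)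
  exact ⟨v, fun s hs => by simpa only [if_pos hs] using hv' s,
    fun i hi => by simpa only [if_neg hi] using hv' i⟩

lemma mulVec_eq_zero_of_isAntichain (hB : IsRateMatrix B) (hS : IsSRoot (influenceGraph B) S)
    (hanti : IsAntichain (ReflTransGen (influenceGraph B).Adj) (S : Set V))
    (hv : ∀ i ∉ S, (B *ᵥ v) i = 0) : B *ᵥ v = 0 := by
  ext i
  by_cases hi : i ∈ S
  · refine hB.mulVec_apply_eq_zero_of_forall_adj fun j hj => ?_
    exact hB.eq_of_forall_root_eq hS hv fun s hs hsj => by rw [hanti.eq hs hi (hsj.tail hj)]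
  · exact hv i hi

lemma kerRestrict_injective (hB : IsRateMatrix B) (hS : IsSRoot (influenceGraph B) S) :
    Function.Injective (kerRestrict B S) := by
  rw [injective_iff_map_eq_zero]
  rintro ⟨v, hv⟩ hres
  ext i
  exact hB.eq_of_forall_root_eq hS (fun j _ => congrFun hv j) fun s hs _ => congrFun hres ⟨s, hs⟩

lemma kerRestrict_surjective (hB : IsRateMatrix B) (hS : IsSRoot (influenceGraph B) S)
    (hanti : IsAntichain (ReflTransGen (influenceGraph B).Adj) (S : Set V)) :
    Function.Surjective (kerRestrict B S) := by
  intro u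
  obtain ⟨u, rfl⟩ := LinearMap.funLeft_surjective_of_injective K K _ Subtype.val_injective u
  obtain ⟨v, hvS, hv⟩ := hB.exists_harmonic_extension hS u
  exact ⟨⟨v, hB.mulVec_eq_zero_of_isAntichain hS hanti hv⟩, funext fun s => hvS s s.2⟩

lemma finrank_ker_le_card (hB : IsRateMatrix B) (hS : IsSRoot (influenceGraph B) S) :
    Module.finrank K (LinearMap.ker B.mulVecLin) ≤ S.card := by
  simpa using LinearMap.finrank_le_finrank_of_injective (hB.kerRestrict_injective hS)

lemma finrank_ker_eq_card (hB : IsRateMatrix B) (hS : IsSRoot (influenceGraph B) S)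
    (hanti : IsAntichain (ReflTransGen (influenceGraph B).Adj) (S : Set V)) :
    Module.finrank K (LinearMap.ker B.mulVecLin) = S.card := by
  simpa using (LinearEquiv.ofBijective (kerRestrict B S)
    ⟨hB.kerRestrict_injective hS, hB.kerRestrict_surjective hS hanti⟩).finrank_eq

theorem isLeast_card_isSRoot (hB : IsRateMatrix B) :
    IsLeast {k : ℕ | ∃ S : Finset V, IsSRoot (influenceGraph B) S ∧ S.card = k}
      (Module.finrank K (LinearMap.ker B.mulVecLin)) := by
  constructor
  · obtain ⟨S, hS, hanti⟩ := exists_isSRoot_isAntichain (influenceGraph B)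
    exact ⟨S, hS, (hB.finrank_ker_eq_card hS hanti).symm⟩
  · rintro _ ⟨S, hS, rfl⟩
    exact hB.finrank_ker_le_card hS

lemma one_add_smul_mem_rowStochastic [DecidableEq V] (hB : IsRateMatrix B) {a : K} (ha : 0 ≤ a)
    (hdiag : ∀ i, 0 ≤ 1 + a * B i i) : 1 + a • B ∈ rowStochastic K V := by
  rw [mem_rowStochastic_iff_sum]
  refine ⟨fun i j => ?_, fun i => ?_⟩
  · rcases eq_or_ne i j with rfl | hij
    · simpa using hdiag i
    · simpa [one_apply_ne hij] using mul_nonneg ha (hB.offDiag_nonneg i j hij)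
  · simp [Finset.sum_add_distrib, ← Finset.mul_sum, hB.sum_row, one_apply]

lemma exists_eq_smul_rowStochastic_sub_one [DecidableEq V] (hB : IsRateMatrix B) :
    ∃ c : K, 0 < c ∧ ∃ P ∈ rowStochastic K V, B = c • (P - 1) := by
  obtain ⟨M, hM⟩ := (Set.finite_range fun i => -B i i).bddAbove
  have hc : 0 < max M 1 := lt_max_of_lt_right one_pos
  set c := max M 1
  have hdiag (i : V) : 0 ≤ 1 + c⁻¹ * B i i := by
    have hle : -B i i ≤ c := (hM (Set.mem_range_self i)).trans (le_max_left M 1)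
    calc 0 ≤ c⁻¹ * (c + B i i) := mul_nonneg (inv_nonneg.2 hc.le) (by linarith)
      _ = 1 + c⁻¹ * B i i := by rw [mul_add, inv_mul_cancel₀ hc.ne']
  refine ⟨c, hc, 1 + c⁻¹ • B,
    hB.one_add_smul_mem_rowStochastic (inv_nonneg.2 hc.le) hdiag, ?_⟩
  rw [add_sub_cancel_left, smul_smul, mul_inv_cancel₀ hc.ne', one_smul]

end IsRateMatrix

end Kernel

section PowerBounded

lemma hasSum_pow_div_factorial (s : ℝ) :
    HasSum (fun k : ℕ => s ^ k / k.factorial) (Real.exp s) := by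
  rw [Real.exp_eq_exp_ℝ]
  exact NormedSpace.expSeries_div_hasSum_exp s

lemma hasSum_pow_div_factorial_mul_natCast_smul {E : Type*} [NormedAddCommGroup E]
    [NormedSpace ℝ E] {s : ℝ} {f : ℕ → E} {a : E}
    (h : HasSum (fun k : ℕ => (s ^ k / k.factorial) • f (k + 1)) a) :
    HasSum (fun k : ℕ => (s ^ k / k.factorial * k) • f k) (s • a) := by
  rw [← hasSum_nat_add_iff' 1]
  simp only [Finset.range_one, Finset.sum_singleton, Nat.cast_zero, mul_zero, zero_smul, sub_zero]
  convert h.const_smul s using 2 with k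
  rw [smul_smul, Nat.factorial_succ]
  congr 1
  push_cast
  field_simp
  ring

/- `exp s` times the variance `1 / s` of `K / s`, where `K` is Poisson with mean `s`. -/
lemma hasSum_pow_div_factorial_mul_sq {s : ℝ} (hs : 0 < s) :
    HasSum (fun k : ℕ => s ^ k / k.factorial * (k / s - 1) ^ 2) (Real.exp s / s) := by
  have h0 := hasSum_pow_div_factorial s
  have h1 : HasSum (fun k : ℕ => s ^ k / k.factorial * k) (s * Real.exp s) := by
    simpa using hasSum_pow_div_factorial_mul_natCast_smul (f := fun _ => (1 : ℝ))
      (by simpa using h0)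
  have h2 : HasSum (fun k : ℕ => s ^ k / k.factorial * k * k)
      (s * (s * Real.exp s + Real.exp s)) :=
    hasSum_pow_div_factorial_mul_natCast_smul (f := fun k => (k : ℝ))
      (by simpa [mul_add] using h1.add h0)
  convert ((h2.mul_left (1 / s ^ 2)).sub (h1.mul_left (2 / s))).add h0 using 1
  · rfl
  · funext k
    field_simp
    ring
  · field_simp
    ring

variable {R : Type*} [NormedRing R] [NormedAlgebra ℝ R] [CompleteSpace R]

lemma hasSum_pow_div_factorial_smul_pow (s : ℝ) (P : R) :
    HasSum (fun k : ℕ => (s ^ k / k.factorial) • P ^ k) (NormedSpace.exp (s • P)) := by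
  convert NormedSpace.exp_series_hasSum_exp' (𝕂 := ℝ) (s • P) using 2 with k
  rw [smul_pow, smul_smul, div_eq_inv_mul]

lemma hasSum_exp_smul_mul_sub_one {s : ℝ} (hs : s ≠ 0) (P : R) :
    HasSum (fun k : ℕ => (s ^ k / k.factorial * (k / s - 1)) • P ^ k)
      (NormedSpace.exp (s • P) * (P - 1)) := by
  have h0 := hasSum_pow_div_factorial_smul_pow s P
  have h1 : HasSum (fun k : ℕ => (s ^ k / k.factorial * k) • P ^ k)
      (s • (NormedSpace.exp (s • P) * P)) :=
    hasSum_pow_div_factorial_mul_natCast_smul (by simpa [pow_succ] using h0.mul_right P)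
  convert (h1.const_smul s⁻¹).sub h0 using 1
  · rfl
  · funext k
    rw [smul_smul, ← sub_smul]
    congr 1
    field_simp
  · rw [inv_smul_smul₀ hs, mul_sub, mul_one]

lemma norm_exp_smul_mul_sub_one_le {s C : ℝ} (hs : 0 < s) {P : R} (hP : ∀ k : ℕ, ‖P ^ k‖ ≤ C) :
    ‖NormedSpace.exp (s • P) * (P - 1)‖ ≤ Real.exp s * (C / √s) := by
  have : 0 < √s := Real.sqrt_pos.2 hs
  have : 0 ≤ C := (norm_nonneg _).trans (hP 0)
  have am_gm (y : ℝ) : |y| ≤ (1 / √s + √s * y ^ 2) / 2 := by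
    have : (1 / √s + √s * y ^ 2) / 2 - |y| = (1 - √s * |y|) ^ 2 / (2 * √s) := by
      rw [← sq_abs y]
      field_simp
      ring
    exact sub_nonneg.1 (this ▸ by positivity)
  have hsum := (((hasSum_pow_div_factorial s).mul_left (1 / √s)).add
    ((hasSum_pow_div_factorial_mul_sq hs).mul_left √s)).mul_left (C / 2)
  have hterm (k : ℕ) : ‖(s ^ k / k.factorial * (k / s - 1)) • P ^ k‖ ≤
      C / 2 * (1 / √s * (s ^ k / k.factorial) + √s * (s ^ k / k.factorial * (k / s - 1) ^ 2)) := by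
    have hweight : 0 ≤ s ^ k / (k.factorial : ℝ) := by positivity
    calc ‖(s ^ k / k.factorial * (k / s - 1)) • P ^ k‖
        = s ^ k / k.factorial * |k / s - 1| * ‖P ^ k‖ := by
          rw [norm_smul, Real.norm_eq_abs, abs_mul, abs_of_nonneg hweight]
      _ ≤ s ^ k / k.factorial * ((1 / √s + √s * (k / s - 1) ^ 2) / 2) * C := by
          gcongr
          exacts [am_gm _, hP k]
      _ = _ := by ring
  calc ‖NormedSpace.exp (s • P) * (P - 1)‖
      ≤ C / 2 * (1 / √s * Real.exp s + √s * (Real.exp s / s)) := by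
        rw [← (hasSum_exp_smul_mul_sub_one hs.ne' P).tsum_eq]
        exact tsum_of_norm_bounded hsum hterm
    _ = Real.exp s * (C / √s) := by
        rw [mul_div_left_comm √s, Real.sqrt_div_self']
        ring

lemma exp_smul_sub_one (s : ℝ) (P : R) :
    NormedSpace.exp (s • (P - 1)) = Real.exp (-s) • NormedSpace.exp (s • P) := by
  let : NormedAlgebra ℚ R := NormedAlgebra.restrictScalars ℚ ℝ R
  have hsplit : s • (P - 1) = algebraMap ℝ R (-s) + s • P := by
    rw [Algebra.algebraMap_eq_smul_one, smul_sub, neg_smul]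
    abel
  rw [hsplit, NormedSpace.exp_add_of_commute (Algebra.commutes _ _),
    ← NormedSpace.algebraMap_exp_comm, ← Real.exp_eq_exp_ℝ, ← Algebra.smul_def]

lemma norm_exp_smul_sub_one_mul_le {s C : ℝ} (hs : 0 < s) {P : R} (hP : ∀ k : ℕ, ‖P ^ k‖ ≤ C) :
    ‖NormedSpace.exp (s • (P - 1)) * (P - 1)‖ ≤ C / √s := by
  rw [exp_smul_sub_one, smul_mul_assoc, norm_smul, Real.norm_eq_abs, Real.abs_exp, Real.exp_neg,
    inv_mul_le_iff₀ (Real.exp_pos s)]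
  exact norm_exp_smul_mul_sub_one_le hs hP

lemma tendsto_exp_smul_sub_one_mul {C : ℝ} {P : R} (hP : ∀ k : ℕ, ‖P ^ k‖ ≤ C) :
    Tendsto (fun s : ℝ => NormedSpace.exp (s • (P - 1)) * (P - 1)) atTop (𝓝 0) := by
  refine squeeze_zero_norm' ?_ (Real.tendsto_sqrt_atTop.const_div_atTop C)
  filter_upwards [eventually_gt_atTop 0] with s hs
  exact norm_exp_smul_sub_one_mul_le hs hP

end PowerBounded

section MatrixExponential

open scoped Matrix.Norms.Operator

variable {V : Type*} [Fintype V] [DecidableEq V] {B : Matrix V V ℝ}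

lemma linfty_opNorm_le_one_of_mem_rowStochastic {P : Matrix V V ℝ} (hP : P ∈ rowStochastic ℝ V) :
    ‖P‖ ≤ 1 := by
  rw [← coe_nnnorm, NNReal.coe_le_one, linfty_opNNNorm_def]
  refine Finset.sup_le fun i _ => ?_
  rw [← NNReal.coe_le_one, NNReal.coe_sum]
  simp only [coe_nnnorm, Real.norm_of_nonneg (nonneg_of_mem_rowStochastic hP),
    sum_row_of_mem_rowStochastic hP, le_refl]

lemma IsRateMatrix.tendsto_exp_smul_mul (hB : IsRateMatrix B) :
    Tendsto (fun s : ℝ => NormedSpace.exp (s • B) * B) atTop (𝓝 0) := by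
  obtain ⟨c, hc, P, hP, rfl⟩ := hB.exists_eq_smul_rowStochastic_sub_one
  have hpow (k : ℕ) : ‖P ^ k‖ ≤ 1 :=
    linfty_opNorm_le_one_of_mem_rowStochastic (pow_mem hP k)
  have hlim := ((tendsto_exp_smul_sub_one_mul hpow).comp
    (tendsto_id.atTop_mul_const hc)).const_smul c
  simp only [Function.comp_def, id, smul_zero] at hlim
  simp only [mul_smul_comm, smul_smul]
  exact hlim

lemma exp_mulVec_of_mulVec_eq_zero {v : V → ℝ} (hv : B *ᵥ v = 0) :
    NormedSpace.exp B *ᵥ v = v := by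
  have hcont : Continuous fun M : Matrix V V ℝ => M *ᵥ v :=
    continuous_id.matrix_mulVec continuous_const
  have hsum := (NormedSpace.exp_series_hasSum_exp' (𝕂 := ℝ) B).map
    ((mulVecBilin ℝ ℝ).flip v) hcont
  refine hsum.unique ?_
  convert hasSum_single (0 : ℕ) fun k hk => ?_ using 1
  · simp
  · obtain ⟨k, rfl⟩ := Nat.exists_eq_succ_of_ne_zero hk
    simp [pow_succ, hv]

end MatrixExponential

section TimeInvariantChain

variable {N : ℕ} {A : ℝ → Matrix (Fin N) (Fin N) ℝ} {B : Matrix (Fin N) (Fin N) ℝ} {τ : ℝ}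

lemma unboundedInteractionsGraph_eq_influenceGraph (hA : ∀ t, 0 ≤ t → A t = B) :
    unboundedInteractionsGraph A = influenceGraph B := by
  ext i j
  have hlintegral :
      ∫⁻ t in Set.Ici (0 : ℝ), ENNReal.ofReal (A t j i) = ENNReal.ofReal (B j i) * ⊤ := by
    rw [setLIntegral_congr_fun (g := fun _ => ENNReal.ofReal (B j i)) measurableSet_Ici
      fun t ht => by rw [hA t ht], setLIntegral_const, Real.volume_Ici]
  simp only [unboundedInteractionsGraph, influenceGraph, hlintegral, ENNReal.mul_eq_top]
  simp

lemma peanoBakerTerm_eq (hA : ∀ t, τ ≤ t → A t = B) (k : ℕ) {t : ℝ} (ht : τ ≤ t) :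
    peanoBakerTerm A τ k t = ((t - τ) ^ k / k.factorial) • B ^ k := by
  induction k generalizing t with
  | zero => simp [peanoBakerTerm]
  | succ k ih =>
    ext i j
    have hintegrand : Set.EqOn (fun σ => (A σ * peanoBakerTerm A τ k σ) i j)
        (fun σ => (σ - τ) ^ k * ((B ^ (k + 1)) i j / k.factorial)) (Set.uIcc τ t) := by
      intro σ hσ
      rw [Set.uIcc_of_le ht] at hσ
      simp only [hA σ hσ.1, ih hσ.1, Matrix.mul_smul, ← pow_succ', Matrix.smul_apply,
        smul_eq_mul]
      ring
    calc peanoBakerTerm A τ (k + 1) t i j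
        = ∫ σ in τ..t, (σ - τ) ^ k * ((B ^ (k + 1)) i j / k.factorial) :=
          intervalIntegral.integral_congr hintegrand
      _ = (t - τ) ^ (k + 1) / (k + 1) * ((B ^ (k + 1)) i j / k.factorial) := by
          simp [intervalIntegral.integral_comp_sub_right (fun x => x ^ k) τ]
      _ = (((t - τ) ^ (k + 1) / (k + 1).factorial) • B ^ (k + 1)) i j := by
          rw [Matrix.smul_apply, smul_eq_mul, Nat.factorial_succ]
          push_cast
          field_simp

open scoped Matrix.Norms.Operator in
lemma stateTransition_eq_exp (hA : ∀ t, τ ≤ t → A t = B) {t : ℝ} (ht : τ ≤ t) :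
    stateTransition A t τ = NormedSpace.exp ((t - τ) • B) := by
  ext i j
  have hsum := hasSum_pow_div_factorial_smul_pow (t - τ) B
  simp only [stateTransition, of_apply, peanoBakerTerm_eq hA _ ht]
  exact (Pi.hasSum.1 (Pi.hasSum.1 hsum i) j).tsum_eq

lemma mem_chainNull_iff (hA : ∀ t, τ ≤ t → A t = B) {v : Fin N → ℝ} :
    v ∈ chainNull A τ ↔ Tendsto (fun s : ℝ => NormedSpace.exp (s • B) *ᵥ v) atTop (𝓝 0) := by
  have hshift : (fun t : ℝ => stateTransition A t τ *ᵥ v) =ᶠ[atTop]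
      (fun s : ℝ => NormedSpace.exp (s • B) *ᵥ v) ∘ fun t => t - τ := by
    filter_upwards [eventually_ge_atTop τ] with t ht
    simp only [stateTransition_eq_exp hA ht, Function.comp_apply]
  change Tendsto (fun t : ℝ => stateTransition A t τ *ᵥ v) atTop (𝓝 0) ↔ _
  rw [tendsto_congr' hshift, ← tendsto_map'_iff, map_sub_atTop_eq]

open scoped Matrix.Norms.Operator in
lemma IsRateMatrix.range_mulVecLin_le_chainNull (hB : IsRateMatrix B)
    (hA : ∀ t, τ ≤ t → A t = B) : LinearMap.range B.mulVecLin ≤ chainNull A τ := by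
  rintro _ ⟨w, rfl⟩
  rw [mem_chainNull_iff hA]
  have hcont : Continuous fun M : Matrix (Fin N) (Fin N) ℝ => M *ᵥ w :=
    continuous_id.matrix_mulVec continuous_const
  have hlim := (hcont.tendsto 0).comp hB.tendsto_exp_smul_mul
  simpa only [Function.comp_def, ← mulVec_mulVec, zero_mulVec, mulVecLin_apply] using hlim

lemma disjoint_chainNull_ker_mulVecLin (hA : ∀ t, τ ≤ t → A t = B) :
    Disjoint (chainNull A τ) (LinearMap.ker B.mulVecLin) := by
  rw [Submodule.disjoint_def]
  intro v hnull hker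
  have hfix (s : ℝ) : NormedSpace.exp (s • B) *ᵥ v = v :=
    exp_mulVec_of_mulVec_eq_zero (by rw [smul_mulVec, ← mulVecLin_apply, hker, smul_zero])
  have hlim := (mem_chainNull_iff hA).1 hnull
  simp only [hfix] at hlim
  exact tendsto_nhds_unique tendsto_const_nhds hlim

theorem IsRateMatrix.chainNull_eq_range_mulVecLin (hB : IsRateMatrix B)
    (hA : ∀ t, τ ≤ t → A t = B) : chainNull A τ = LinearMap.range B.mulVecLin :=
  eq_range_of_range_le_of_disjoint_ker (hB.range_mulVecLin_le_chainNull hA)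
    (disjoint_chainNull_ker_mulVecLin hA)

theorem IsRateMatrix.chainRank_eq_finrank_ker (hB : IsRateMatrix B)
    (hA : ∀ t, 0 ≤ t → A t = B) :
    chainRank A = Module.finrank ℝ (LinearMap.ker B.mulVecLin) := by
  have hrn := B.mulVecLin.finrank_range_add_finrank_ker
  rw [Module.finrank_fin_fun] at hrn
  rw [chainRank, chainNullity, hB.chainNull_eq_range_mulVecLin hA]
  lia

end TimeInvariantChain

theorem corollary5 (N : ℕ) (Ahat : Matrix (Fin N) (Fin N) ℝ)
    (hrow : ∀ i : Fin N, ∑ j : Fin N, Ahat i j = 0)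
    (hoff : ∀ i j : Fin N, i ≠ j → 0 ≤ Ahat i j)
    (A : ℝ → Matrix (Fin N) (Fin N) ℝ)
    (hA : ∀ t : ℝ, 0 ≤ t → A t = Ahat) :
    (∀ τ : ℝ, 0 ≤ τ → Module.finrank ℝ (chainNull A τ) = chainNullity A) ∧
    chainRank A = Module.finrank ℝ (LinearMap.ker Ahat.mulVecLin) ∧
    IsLeast {k : ℕ | ∃ S : Finset (Fin N),
      IsSRoot (unboundedInteractionsGraph A) S ∧ S.card = k} (chainRank A) := by
  have hB : IsRateMatrix Ahat := ⟨hrow, hoff⟩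
  have hnull (τ : ℝ) (hτ : 0 ≤ τ) : chainNull A τ = LinearMap.range Ahat.mulVecLin :=
    hB.chainNull_eq_range_mulVecLin fun t ht => hA t (hτ.trans ht)
  have hrank := hB.chainRank_eq_finrank_ker hA
  refine ⟨fun τ hτ => ?_, hrank, ?_⟩
  · rw [chainNullity, hnull τ hτ, hnull 0 le_rfl]
  · rw [hrank, unboundedInteractionsGraph_eq_influenceGraph hA]
    exact hB.isLeast_card_isSRoot
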